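/- There is a $2$-generator recursive presentation $Q$ whose group $\overline{Q}$ has infinite torsion length; moreover $Q$ can be taken of the explicit form $Q=\mathrm{tgen}(P_0*P_1*P_2*\cdots)$. Here the notions are as follows. A presentation $\langle X\mid R\rangle$ has as relators words in the letters $X^{\pm1}$, and $\overline{\langle X\mid R\rangle}$ denotes the group it presents. It is a *recursive presentation* if $X$ is finite and $R$ is recursively enumerable; it is a *countably generated recursive presentation* if instead $X$ is given by an enumeration $x_1,x_2,\dots$ of its letters and $R$ is recursively enumerable as a set of words in the indexed letters. For a group $G$ let $\mathrm{Tor}_0(G)=\{e\}$, let $\mathrm{Tor}_{i+1}(G)$ be the normal closure in $G$ of $\{g\in G : g\,\mathrm{Tor}_i(G)\text{ has finite order in }G/\mathrm{Tor}_i(G)\}$, and let $\mathrm{Tor}_\infty(G)=\bigcup_{i\in\mathbb N}\mathrm{Tor}_i(G)$. The *torsion length* of $G$ is the least $n\in\mathbb N$ with $\mathrm{Tor}_n(G)=\mathrm{Tor}_\infty(G)$, and is $\infty$ if there is no such $n$. For $n\in\mathbb N$ let $$P_n=\Big\langle x_\eta\ \big(\eta\in\textstyle\bigcup_{i=0}^{n-1}\{0,1\}^i\big)\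 \Big|\ x_\eta^3=e\ \big(\eta\in\{0,1\}^{n-1}\big),\ x_{\eta0}x_{\eta1}=x_\eta^3\ \big(\eta\in\textstyle\bigcup_{i=0}^{n-2}\{0,1\}^i\big)\Big\rangle$$ (so $P_0$ is the empty presentation), and let $P=P_0*P_1*P_2*\cdots$ be the free product presentation, i.e. the disjoint union of generators and of relators. For a countably generated recursive presentation $\langle X\mid R\rangle$ with a fixed enumeration $x_1,x_2,\dots$ of its letters without repetition, and $x_0$ the empty word, $\mathrm{tgen}(\langle X\mid R\rangle)$ is the presentation on the two generators $a,t$ obtained from $$\big\langle X,a,b,t\ \big|\ R,\ t^{-1}x_ib^{-i}ab^it=a^{-i}ba^i\ \ (i\ge0)\big\rangle$$ by removing the generators $b$ and $x_i$ $(i\ge1)$ and substituting for them, in all relators, $b=t^{-1}at$ and $x_i=t\,a^{-i}ba^i\,t^{-1}\,(b^{-i}ab^i)^{-1}$. Precisely: there is a computable bijective enumeration of the letters of $P$ (each letter being given as a pair $(n,\eta)$) with respect to which $P$ is a countably generated recursive presentation, and such that the two-generator presentation $Q=\mathrm{tgen}(P)$ formed with this enumeration is a recursive presentation and $\overline{Q}$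 has infinite torsion length. -/

import Mathlib

namespace TorLen

/-! ### Words and presentations -/

/-- Words in the letters `X` and their formal inverses: `(x, true)` stands for `x` and
`(x, false)` for `x⁻¹`, as in `FreeGroup.mk`. -/
abbrev Word (X : Type) : Type := List (X × Bool)

namespace Word

/-- The one-letter word `x`. -/
def letter {X : Type} (x : X) : Word X := [(x, true)]

/-- The formal inverse of a word. -/
def inv {X : Type} (w : Word X) : Word X := FreeGroup.invRev w

/-- The word `w w ⋯ w` (`n` copies). -/
def pow {X : Type} (w : Word X) (n : ℕ) : Word X := (List.replicate n w).flatten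

/-- The word `v⁻¹ u v`. -/
def conj {X : Type} (u v : Word X) : Word X := inv v ++ u ++ v

/-- The relator `u v⁻¹`, which expresses the relation `u = v`. -/
def rel {X : Type} (u v : Word X) : Word X := u ++ inv v

/-- Renaming of letters. -/
def relabel {X Y : Type} (f : X → Y) (w : Word X) : Word Y := w.map (Prod.map f id)

/-- Replacement of every letter `x` by the word `σ x`, and of `x⁻¹` by the inverse word. -/
def subst {X Y : Type} (σ : X → Word Y) (w : Word X) : Word Y :=
  w.flatMap fun p => if p.2 then σ p.1 else inv (σ p.1)

end Word

/-- A group presentation `⟨X | R⟩`, whose relators are words in `X`. -/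
structure Presentation (X : Type) where
  rels : Set (Word X)

/-- The group presented by a presentation. -/
abbrev Presentation.group {X : Type} (P : Presentation X) : Type :=
  PresentedGroup (FreeGroup.mk '' P.rels)

/-- A recursive presentation: finitely many generators, and a recursively enumerable set of
relators. -/
def Presentation.IsRecursive {X : Type} [Finite X] [Primcodable X] (P : Presentation X) : Prop :=
  REPred fun w : Word X => w ∈ P.rels

/-- A countably generated recursive presentation, with respect to an enumeration
`x 0, x 1, x 2, …` of its generators: the relators, written as words in the indices of the
letters, form a recursively enumerable set. -/
def Presentation.IsRecursiveVia {X : Type} (P : Presentation X) (x : ℕ ≃ X) : Prop :=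
  REPred fun w : Word ℕ => w.relabel x ∈ P.rels

/-- The free product presentation of a family: disjoint union of generators and of relators. -/
def freeProd {ι : Type} {X : ι → Type} (P : ∀ i, Presentation (X i)) :
    Presentation (Σ i, X i) where
  rels := ⋃ i, Word.relabel (Sigma.mk i) '' (P i).rels

/-! ### Iterated torsion subgroups and torsion length -/

section Torsion

variable (G : Type*) [Group G]

/-- The subgroups `Tor_i(G)`, together with their normality: `Tor_0(G)` is trivial, and
`Tor_{i+1}(G)` is the normal closure of all `g` whose image in `G / Tor_i(G)` is torsion. -/
def torAux : ℕ → {N : Subgroup G // N.Normal}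
  | 0 => ⟨⊥, inferInstance⟩
  | i + 1 =>
    let N := torAux i
    haveI : N.1.Normal := N.2
    ⟨Subgroup.normalClosure {g : G | IsOfFinOrder (QuotientGroup.mk g : G ⧸ N.1)}, inferInstance⟩

/-- `Tor_i(G)`. -/
def tor (i : ℕ) : Subgroup G := (torAux G i).1

/-- `Tor_∞(G)`, the union of all `Tor_i(G)`. -/
def torInf : Set G := ⋃ i : ℕ, (tor G i : Set G)

/-- The torsion length of `G`: the least `n` with `Tor_n(G) = Tor_∞(G)`, and `⊤` if there is no
such `n`. -/
noncomputable def torsionLength : ℕ∞ :=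
  sInf {l : ℕ∞ | ∃ n : ℕ, l = n ∧ (tor G n : Set G) = torInf G}

end Torsion

/-! ### The finite presentations `P_n` -/

/-- The generators of `P_n`: letters `x_η` for the binary strings `η` of length less than `n`. -/
abbrev StringsBelow (n : ℕ) : Type := {η : List Bool // η.length < n}

/-- The letter `x_η`, as a word. -/
def strLetter {n : ℕ} (η : List Bool) (h : η.length < n) : Word (StringsBelow n) :=
  Word.letter ⟨η, h⟩

/-- The presentation `P_n`, with generators `x_η` (`η` a binary string of length `< n`) and
relations `x_η ^ 3 = e` for `η` of length `n - 1`, and `x_{η0} x_{η1} = x_η ^ 3` for `η` of length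
less than `n - 1`. -/
def finPres (n : ℕ) : Presentation (StringsBelow n) where
  rels :=
    {w | ∃ (η : List Bool) (h : η.length < n), η.length + 1 = n ∧
      w = (strLetter η h).pow 3} ∪
    {w | ∃ (η : List Bool) (h : η.length < n)
      (h₀ : (η ++ [false]).length < n) (h₁ : (η ++ [true]).length < n),
      w = Word.rel (strLetter (η ++ [false]) h₀ ++ strLetter (η ++ [true]) h₁)
        ((strLetter η h).pow 3)}

/-! ### The embedding into a two-generator group -/

/-- The generators of the HNN extension: those of the given presentation, and `a`, `b`, `t`. -/
inductive HNNLetter (X : Type) : Type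
  | base (x : X)
  | a
  | b
  | t

/-- The presentation
`⟨X, a, b, t | R, t⁻¹ x_i b⁻ⁱ a bⁱ t = a⁻ⁱ b aⁱ for all i ≥ 0⟩`, where `x_0` is the empty word and
`x_1, x_2, …` is the enumeration of the letters of `X` (so `x_{i+1}` is `x i` below). -/
def hnnPres {X : Type} (P : Presentation X) (x : ℕ ≃ X) : Presentation (HNNLetter X) where
  rels :=
    Word.relabel HNNLetter.base '' P.rels ∪
    {Word.rel ((Word.letter HNNLetter.a).conj (Word.letter HNNLetter.t)) (Word.letter HNNLetter.b)} ∪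
    Set.range fun i : ℕ =>
      Word.rel
        ((Word.letter (HNNLetter.base (x i)) ++
          (Word.letter HNNLetter.a).conj ((Word.letter HNNLetter.b).pow (i + 1))).conj (Word.letter HNNLetter.t))
        ((Word.letter HNNLetter.b).conj ((Word.letter HNNLetter.a).pow (i + 1)))

/-- The first of the two generators, `a`. -/
def genA : Word (Fin 2) := Word.letter 0

/-- The second of the two generators, `t`. -/
def genT : Word (Fin 2) := Word.letter 1

/-- The word `t⁻¹ a t`, which expresses `b`. -/
def wordB : Word (Fin 2) := genA.conj genT

/-- The word `t a⁻ⁱ b aⁱ t⁻¹ (b⁻ⁱ a bⁱ)⁻¹` with `b = t⁻¹ a t`, which expresses `x_i`. -/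
def wordX (i : ℕ) : Word (Fin 2) :=
  genT ++ wordB.conj (genA.pow i) ++ genT.inv ++ (genA.conj (wordB.pow i)).inv

/-- The words in `a` and `t` by which the generators of the HNN extension are expressed. -/
def elimLetter {X : Type} (x : ℕ ≃ X) : HNNLetter X → Word (Fin 2)
  | .base y => wordX (x.symm y + 1)
  | .a => genA
  | .b => wordB
  | .t => genT

/-- The two-generator presentation obtained by removing `X` and `b` from the generators of the HNN
extension and substituting for them in the relators. -/
def tgen {X : Type} (P : Presentation X) (x : ℕ ≃ X) : Presentation (Fin 2) where
  rels := Word.subst (elimLetter x) '' (hnnPres P x).rels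

end TorLen

namespace TorLen

/-! For every `m`, the root letter `x_∅` of `P_{m+1}` gives an element of `Tor_{m+1}` of the
two-generator group lying outside `Tor_m`.

Membership climbs the binary tree: leaves have order dividing 3, and the cube of an inner letter is
the product of its two children (`mem_tor_of_satisfies`).

For non-membership, call a homomorphism torsion-killing if it is trivial on all elements of finite
order; it carries `Tor_{i+1}` into `Tor_i` (`KillsTorsion.tor_succ_le_comap`). Start with `A_0 =
ℤ/3` and its generator `u_0`, and obtain `A_{n+1}` from `A_n` by adjoining a free letter `s` and a
cube root `u_{n+1}` of `u_n · s u_n s⁻¹`. Then `A_m` satisfies the relations of `P_{m+1}` with `x_∅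
= u_m`, and torsion-killing maps `A_{n+1} → A_n` send `u_{n+1}` to `u_n`. The two-generator group
maps to an HNN extension `TwoGen` of `A_m × F_2`, with `x_∅` going to `u_m`. The maps of the tower
extend to torsion-killing maps between these extensions, so descending `m` levels puts `u_m` outside
`Tor_m`, because `u_0 ≠ 1`. Only this homomorphism is needed, not an isomorphism with `TwoGen`.

All extensions are handled by one fact: torsion in an HNN extension is conjugate into the base, so
killing torsion can be tested on the base (`killsTorsion_of_comp_of`).

Recursiveness holds because each letter owns exactly one relator, computable from the index of the
letter. -/

/-! ### Homomorphisms that kill torsion -/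

/-- A homomorphism that sends every element of finite order to the identity. -/
def KillsTorsion {G K : Type*} [Group G] [Group K] (f : G →* K) : Prop :=
  ∀ g, IsOfFinOrder g → f g = 1

instance tor_normal (G : Type*) [Group G] (i : ℕ) : (tor G i).Normal := (torAux G i).2

theorem tor_zero (G : Type*) [Group G] : tor G 0 = ⊥ := rfl

theorem tor_succ (G : Type*) [Group G] (i : ℕ) :
    tor G (i + 1) =
      Subgroup.normalClosure {g : G | IsOfFinOrder (QuotientGroup.mk g : G ⧸ tor G i)} := rfl

theorem isOfFinOrder_mk_iff {G : Type*} [Group G] {N : Subgroup G} [N.Normal] {g : G} :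
    IsOfFinOrder (QuotientGroup.mk g : G ⧸ N) ↔ ∃ n, 0 < n ∧ g ^ n ∈ N := by
  rw [isOfFinOrder_iff_pow_eq_one]
  refine exists_congr fun n => and_congr_right fun _ => ?_
  rw [← QuotientGroup.mk_pow, QuotientGroup.eq_one_iff]

theorem mem_tor_succ {G : Type*} [Group G] {i n : ℕ} {g : G} (hn : 0 < n)
    (h : g ^ n ∈ tor G i) : g ∈ tor G (i + 1) := by
  rw [tor_succ]
  exact Subgroup.subset_normalClosure (isOfFinOrder_mk_iff.2 ⟨n, hn, h⟩)

theorem tor_succ_le {G : Type*} [Group G] {i : ℕ} {N : Subgroup G} [N.Normal]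
    (h : ∀ (g : G) (n : ℕ), 0 < n → g ^ n ∈ tor G i → g ∈ N) : tor G (i + 1) ≤ N := by
  rw [tor_succ]
  refine Subgroup.normalClosure_le_normal fun g hg => ?_
  obtain ⟨n, hn, h'⟩ := isOfFinOrder_mk_iff.1 hg
  exact h g n hn h'

theorem tor_le_comap {G K : Type*} [Group G] [Group K] (f : G →* K) (i : ℕ) :
    tor G i ≤ (tor K i).comap f := by
  induction i with
  | zero => simp [tor_zero]
  | succ i ih =>
    refine tor_succ_le fun g n hn hg => ?_
    have := ih hg
    rw [Subgroup.mem_comap, map_pow] at this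
    exact mem_tor_succ hn this

/-- Killing torsion gains one level at the bottom, `Tor_1` going to the trivial group; functoriality
carries the gain upwards. -/
theorem KillsTorsion.tor_succ_le_comap {G K : Type*} [Group G] [Group K] {f : G →* K}
    (hf : KillsTorsion f) (i : ℕ) : tor G (i + 1) ≤ (tor K i).comap f := by
  induction i with
  | zero =>
    refine tor_succ_le fun g n hn hg => ?_
    rw [tor_zero, Subgroup.mem_bot] at hg
    rw [Subgroup.mem_comap, tor_zero, Subgroup.mem_bot]
    exact hf g (isOfFinOrder_iff_pow_eq_one.2 ⟨n, hn, hg⟩)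
  | succ i ih =>
    refine tor_succ_le fun g n hn hg => ?_
    have := ih hg
    rw [Subgroup.mem_comap, map_pow] at this
    exact mem_tor_succ hn this

theorem torsionLength_eq_top {G : Type*} [Group G]
    (h : ∀ n, ∃ m, ∃ g ∈ tor G m, g ∉ tor G n) : torsionLength G = ⊤ := by
  have : {l : ℕ∞ | ∃ n : ℕ, l = n ∧ (tor G n : Set G) = torInf G} = ∅ := by
    refine Set.eq_empty_of_forall_notMem fun l => ?_
    rintro ⟨n, -, hn⟩
    obtain ⟨m, g, hg, hg'⟩ := h n
    refine hg' (?_ : g ∈ (tor G n : Set G))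
    rw [hn]
    exact Set.mem_iUnion.2 ⟨m, hg⟩
  rw [torsionLength, this, sInf_empty]

/-! ### Torsion in HNN extensions -/

section HNN

open HNNExtension HNNExtension.NormalWord

variable {G : Type*} [Group G] {A B : Subgroup G} (φ : A ≃* B)

/-- The product `t ^ ε₁ * g₁ * ⋯ * t ^ εₖ * gₖ`. -/
def syllables (l : List (ℤˣ × G)) : HNNExtension G A B φ :=
  (l.map fun x => t ^ (x.1 : ℤ) * of x.2).prod

/-- The syllables `x`, `y` do not give rise to a reduction when they are adjacent. -/
def NoPinch (A B : Subgroup G) (x y : ℤˣ × G) : Prop :=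
  x.2 ∈ toSubgroup A B x.1 → x.1 = y.1

theorem syllables_append (l l' : List (ℤˣ × G)) :
    syllables φ (l ++ l') = syllables φ l * syllables φ l' := by
  simp [syllables]

/-- Britton's lemma. -/
theorem syllables_notMem_range {l : List (ℤˣ × G)} (hl : l ≠ [])
    (h : l.IsChain (NoPinch A B)) :
    syllables φ l ∉ (of : G →* HNNExtension G A B φ).range := by
  intro hr
  refine hl (ReducedWord.toList_eq_nil_of_mem_of_range φ ⟨1, l, h⟩ ?_)
  simpa [ReducedWord.prod, syllables] using hr

theorem isChain_flatten_replicate {α : Type*} {R : α → α → Prop} {l : List α} (hl : l ≠ [])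
    (h : (l ++ l).IsChain R) (n : ℕ) : (List.replicate n l).flatten.IsChain R := by
  obtain ⟨a, l, rfl⟩ := List.exists_cons_of_ne_nil hl
  rw [List.isChain_append] at h
  induction n with
  | zero => simp
  | succ n ih =>
    rw [List.replicate_succ, List.flatten_cons, List.isChain_append]
    refine ⟨h.1, ih, fun x hx y hy => h.2.2 x hx y ?_⟩
    cases n with
    | zero => simp at hy
    | succ n => simpa [List.replicate_succ] using hy

/-- A nonempty cyclically reduced word represents an element of infinite order. -/
theorem not_isOfFinOrder_syllables {l : List (ℤˣ × G)} (hl : l ≠ [])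
    (h : (l ++ l).IsChain (NoPinch A B)) : ¬ IsOfFinOrder (syllables φ l) := by
  rw [isOfFinOrder_iff_pow_eq_one]
  rintro ⟨n, hn, h1⟩
  have hpow : ∀ n, syllables φ (List.replicate n l).flatten = syllables φ l ^ n := fun n => by
    induction n with
    | zero => simp [syllables]
    | succ n ih => rw [List.replicate_succ, List.flatten_cons, syllables_append, ih, pow_succ']
  -- Powers of a cyclically reduced word are reduced, so they never return to the base, let alone to
  -- 1.
  refine syllables_notMem_range φ (l := (List.replicate n l).flatten) ?_
    (isChain_flatten_replicate hl h n) ?_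
  · cases n with
    | zero => omega
    | succ n => simp [List.replicate_succ, hl]
  · rw [hpow, h1]
    exact one_mem _

theorem t_zpow_mul_of_mul (u : ℤˣ) {g : G} (hg : g ∈ toSubgroup A B u) :
    ∃ g' : G, (t ^ (u : ℤ) * of g * t ^ (-(u : ℤ)) : HNNExtension G A B φ) = of g' := by
  obtain rfl | rfl := Int.units_eq_one_or u
  · exact ⟨φ ⟨g, hg⟩, by simpa using (equiv_eq_conj (φ := φ) ⟨g, hg⟩).symm⟩
  · exact ⟨φ.symm ⟨g, hg⟩, by simpa using (equiv_symm_eq_conj (φ := φ) ⟨g, hg⟩).symm⟩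

theorem isConj_mul_comm {H : Type*} [Group H] (x y : H) : IsConj (x * y) (y * x) :=
  isConj_iff.2 ⟨y, by group⟩

/-- Cyclic reduction. Conjugation moves `g` behind the last syllable. Finite order excludes a
cyclically reduced word, so there is a pinch where the end meets the beginning; rotating the word
removes two syllables. -/
theorem exists_isConj_of_of_isOfFinOrder_syllables (n : ℕ) (l : List (ℤˣ × G)) (g : G)
    (hn : l.length = n) (hl : l.IsChain (NoPinch A B))
    (h : IsOfFinOrder (of g * syllables φ l)) :
    ∃ g' : G, IsConj (of g * syllables φ l) (of g' : HNNExtension G A B φ) := by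
  induction n using Nat.strong_induction_on generalizing l g with
  | _ n ih =>
  obtain rfl | ⟨l₀, ⟨e, k⟩, rfl⟩ := l.eq_nil_or_concat'
  · exact ⟨g, by rw [syllables, List.map_nil, List.prod_nil, mul_one]⟩
  have hc : IsConj (of g * syllables φ (l₀ ++ [(e, k)])) (syllables φ (l₀ ++ [(e, k * g)])) := by
    refine (isConj_mul_comm _ _).trans ?_
    have : syllables φ (l₀ ++ [(e, k)]) * of g = syllables φ (l₀ ++ [(e, k * g)]) := by
      simp [syllables, mul_assoc]
    rw [this]
  have hfin := hc.isOfFinOrder h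
  have hl₀ : l₀.IsChain (NoPinch A B) := (List.isChain_append.1 hl).1
  have hl' : (l₀ ++ [(e, k * g)]).IsChain (NoPinch A B) := by
    rw [List.isChain_append] at hl ⊢
    refine ⟨hl.1, by simp, fun x hx y hy => ?_⟩
    have := hl.2.2 x hx (e, k) (by simp)
    simp only [List.head?_cons, Option.mem_some_iff] at hy
    subst hy
    exact this
  by_cases hcyc : ((l₀ ++ [(e, k * g)]) ++ (l₀ ++ [(e, k * g)])).IsChain (NoPinch A B)
  · exact absurd hfin (not_isOfFinOrder_syllables φ (by simp) hcyc)
  rw [List.isChain_append] at hcyc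
  push Not at hcyc
  obtain ⟨x, hx, y, hy, hxy⟩ := hcyc hl' hl'
  simp only [List.getLast?_append, List.getLast?_singleton, Option.some_or,
    Option.mem_some_iff] at hx
  subst hx
  simp only [NoPinch, Classical.not_imp] at hxy
  obtain ⟨hmem, hne⟩ := hxy
  cases l₀ with
  -- A single syllable cannot pinch with itself: the two exponents agree.
  | nil => simp at hy; subst hy; simp at hne
  | cons p l₁ =>
    simp only [List.cons_append, List.head?_cons, Option.mem_some_iff] at hy
    subst hy
    obtain ⟨e₁, k₁⟩ := p
    have he : (e₁ : ℤ) = -(e : ℤ) := by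
      obtain rfl | rfl := Int.units_eq_one_or e <;>
      obtain rfl | rfl := Int.units_eq_one_or e₁ <;> simp_all
    obtain ⟨g', hg'⟩ := t_zpow_mul_of_mul φ e hmem
    have hc' : IsConj (of g * syllables φ ((e₁, k₁) :: l₁ ++ [(e, k)]))
        (of (g' * k₁) * syllables φ l₁) := by
      refine hc.trans ?_
      have h1 : syllables φ ((e₁, k₁) :: l₁ ++ [(e, k * g)]) =
          (t ^ (-(e : ℤ)) * of k₁ * syllables φ l₁) * (t ^ (e : ℤ) * of (k * g)) := by
        simp [syllables, he, mul_assoc]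
      rw [h1]
      refine (isConj_mul_comm _ _).trans ?_
      rw [map_mul of g' k₁, ← hg']
      simp only [mul_assoc]
      exact IsConj.refl _
    obtain ⟨g'', hg''⟩ := ih l₁.length (by simp at hn; omega) l₁ (g' * k₁) rfl
      (List.isChain_cons.1 hl₀).2 (hc'.isOfFinOrder h)
    exact ⟨g'', hc'.trans hg''⟩

/-- An element of finite order of an HNN extension is conjugate to an element of the base. -/
theorem exists_isConj_of_of_isOfFinOrder {h : HNNExtension G A B φ} (hh : IsOfFinOrder h) :
    ∃ g : G, IsOfFinOrder g ∧ IsConj h (of g) := by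
  obtain ⟨d⟩ := TransversalPair.nonempty G A B
  obtain ⟨w, rfl⟩ := (NormalWord.equiv φ d).symm.surjective h
  obtain ⟨g, hg⟩ := exists_isConj_of_of_isOfFinOrder_syllables φ _ w.toList w.head rfl w.chain hh
  refine ⟨g, ?_, hg⟩
  exact (Function.Injective.isOfFinOrder_iff (of_injective φ)).1 (hg.isOfFinOrder hh)

/-- An element of finite order is conjugate to a torsion element of the base, so its image is
conjugate to 1. -/
theorem killsTorsion_of_comp_of {K : Type*} [Group K] {f : HNNExtension G A B φ →* K}
    (hf : KillsTorsion (f.comp of)) : KillsTorsion f := by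
  intro h hh
  obtain ⟨g, hg, hc⟩ := exists_isConj_of_of_isOfFinOrder φ hh
  have := f.map_isConj hc
  rw [← MonoidHom.comp_apply, hf g hg, isConj_one_left] at this
  exact this

end HNN

/-! ### HNN extensions given by two embeddings of one group -/

/-- The HNN extension of `G` in which the stable letter conjugates `α c` to `β c`. -/
abbrev ConjExt {C G : Type*} [Group C] [Group G] (α β : C →* G) (hα : Function.Injective α)
    (hβ : Function.Injective β) : Type _ :=
  HNNExtension G α.range β.range ((α.ofInjective hα).symm.trans (β.ofInjective hβ))

namespace ConjExt

variable {C G G' K : Type*} [Group C] [Group G] [Group G'] [Group K] {α β : C →* G}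
  {α' β' : C →* G'} {hα : Function.Injective α} {hβ : Function.Injective β}
  {hα' : Function.Injective α'} {hβ' : Function.Injective β'}

theorem t_conj (c : C) :
    (HNNExtension.t * HNNExtension.of (α c) * HNNExtension.t⁻¹ : ConjExt α β hα hβ) =
      HNNExtension.of (β c) := by
  have := HNNExtension.equiv_eq_conj
    (φ := (α.ofInjective hα).symm.trans (β.ofInjective hβ)) (α.ofInjective hα c)
  rw [MulEquiv.trans_apply, MulEquiv.symm_apply_apply] at this
  exact this.symm

theorem exists_lift (f : G →* K) (s : K) (h : ∀ c, s * f (α c) * s⁻¹ = f (β c)) :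
    ∃ F : ConjExt α β hα hβ →* K,
      (∀ g, F (HNNExtension.of g) = f g) ∧ F HNNExtension.t = s := by
  refine ⟨HNNExtension.lift f s ?_, fun g => HNNExtension.lift_of .., HNNExtension.lift_t ..⟩
  rintro ⟨_, c, rfl⟩
  have : (α.ofInjective hα).symm ⟨α c, c, rfl⟩ = c := (α.ofInjective hα).symm_apply_apply c
  rw [MulEquiv.trans_apply, this, ← mul_inv_eq_iff_eq_mul]
  exact h c

/-- The map `f` need not be injective: it suffices that both extensions use the same group `C` and
that `f` respects its embeddings. -/
theorem exists_map (f : G →* G') (h₁ : ∀ c, f (α c) = α' c) (h₂ : ∀ c, f (β c) = β' c) :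
    ∃ F : ConjExt α β hα hβ →* ConjExt α' β' hα' hβ',
      (∀ g, F (HNNExtension.of g) = HNNExtension.of (f g)) ∧
        F HNNExtension.t = HNNExtension.t :=
  exists_lift (HNNExtension.of.comp f) HNNExtension.t fun c => by
    simp only [MonoidHom.comp_apply, h₁, h₂, t_conj]

end ConjExt

/-! ### Adjoining a cube root of a product of two conjugates -/

theorem killsTorsion_prod {G F K : Type*} [Group G] [Group F] [IsMulTorsionFree F] [Group K]
    {f : G × F →* K} (h : KillsTorsion (f.comp (MonoidHom.inl G F))) : KillsTorsion f := by
  rintro ⟨g, x⟩ hg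
  have hx : x = 1 := (isOfFinOrder_iff_eq_one x).1 ((MonoidHom.snd G F).isOfFinOrder hg)
  subst hx
  exact h g ((MonoidHom.fst G F).isOfFinOrder hg)

/-- The free product of `A` with an infinite cyclic group, as an HNN extension. -/
abbrev FreeStable (A : Type) [Group A] : Type :=
  ConjExt (1 : Unit →* A) 1 (Function.injective_of_subsingleton _)
    (Function.injective_of_subsingleton _)

/-- The product of `u` and its conjugate by the free letter. -/
noncomputable def doubled {A : Type} [Group A] (u : A) : FreeStable A :=
  HNNExtension.of u * (HNNExtension.t * HNNExtension.of u * HNNExtension.t⁻¹)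

/-- This is the purpose of the free letter: `u` may be torsion, but `u · s u s⁻¹` can be identified
with three times a generator of `ℤ`. A conjugate of it is cyclically reduced, the associated
subgroups being trivial. -/
theorem not_isOfFinOrder_doubled {A : Type} [Group A] {u : A} (hu : u ≠ 1) :
    ¬ IsOfFinOrder (doubled u) := by
  intro h
  have hc : IsConj (doubled u) (syllables _ [((1 : ℤˣ), u), (-1, u)]) := by
    refine (isConj_mul_comm _ _).trans ?_
    have : (HNNExtension.t * HNNExtension.of u * HNNExtension.t⁻¹ * HNNExtension.of u :
        FreeStable A) = syllables _ [((1 : ℤˣ), u), (-1, u)] := by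
      simp [syllables, mul_assoc]
    rw [this]
  refine not_isOfFinOrder_syllables _ (List.cons_ne_nil _ _) ?_ (hc.isOfFinOrder h)
  simpa [NoPinch] using hu

/-- The homomorphism `n ↦ (doubled u) ^ n`, into the first factor. -/
noncomputable def doubledHom {A : Type} [Group A] (u : A) :
    Multiplicative ℤ →* FreeStable A × Multiplicative ℤ :=
  (MonoidHom.inl _ _).comp (zpowersHom _ (doubled u))

theorem doubledHom_injective {A : Type} [Group A] {u : A} (hu : u ≠ 1) :
    Function.Injective (doubledHom u) := by
  intro c d h
  have h' : doubled u ^ c.toAdd = doubled u ^ d.toAdd := congrArg Prod.fst h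
  exact Multiplicative.toAdd.injective
    (injective_zpow_iff_not_isOfFinOrder.2 (not_isOfFinOrder_doubled hu) h')

/-- The homomorphism `n ↦ 3 n`, into the second factor. -/
def cubeHom (A : Type) [Group A] : Multiplicative ℤ →* A × Multiplicative ℤ :=
  (MonoidHom.inr _ _).comp (powMonoidHom 3)

theorem cubeHom_injective (A : Type) [Group A] : Function.Injective (cubeHom A) := by
  intro c d h
  exact pow_left_injective three_ne_zero (congrArg Prod.snd h)

/-- The group obtained from `A` by adjoining a free letter `s` and a cube root of
`u * (s * u * s⁻¹)`. -/
abbrev CubeRoot {A : Type} [Group A] (u : A) (hu : u ≠ 1) : Type :=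
  ConjExt (cubeHom (FreeStable A)) (doubledHom u) (cubeHom_injective _) (doubledHom_injective hu)

namespace CubeRoot

variable {A A' : Type} [Group A] [Group A'] {u : A} {hu : u ≠ 1} {u' : A'} {hu' : u' ≠ 1}

/-- The inclusion of the base. -/
noncomputable def incl (u : A) (hu : u ≠ 1) : A →* CubeRoot u hu :=
  HNNExtension.of.comp ((MonoidHom.inl _ _).comp HNNExtension.of)

/-- The free letter. -/
noncomputable def free (u : A) (hu : u ≠ 1) : CubeRoot u hu :=
  HNNExtension.of (HNNExtension.t, 1)

/-- The adjoined cube root. -/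
noncomputable def root (u : A) (hu : u ≠ 1) : CubeRoot u hu :=
  HNNExtension.t * HNNExtension.of (1, Multiplicative.ofAdd 1) * HNNExtension.t⁻¹

theorem root_pow : root u hu ^ 3 = incl u hu u * (free u hu * incl u hu u * (free u hu)⁻¹) := by
  have h := ConjExt.t_conj (α := cubeHom (FreeStable A)) (β := doubledHom u)
    (hα := cubeHom_injective _) (hβ := doubledHom_injective hu) (Multiplicative.ofAdd 1)
  have h2 : doubledHom u (Multiplicative.ofAdd 1) = (doubled u, 1) := by
    simp [doubledHom]
  have h3 : cubeHom (FreeStable A) (Multiplicative.ofAdd 1) =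
      ((1, Multiplicative.ofAdd 1) : FreeStable A × Multiplicative ℤ) ^ 3 := by
    simp [cubeHom]
  rw [h2, h3] at h
  rw [root, conj_pow, ← map_pow, h]
  simp only [incl, free, MonoidHom.comp_apply, ← map_mul, ← map_inv, MonoidHom.inl_apply,
    Prod.mk_mul_mk, Prod.inv_mk, inv_one, mul_one]
  rfl

theorem root_ne_one : root u hu ≠ 1 := by
  intro h
  rw [root, conj_eq_one_iff, map_eq_one_iff _ (HNNExtension.of_injective _), Prod.mk_eq_one] at h
  exact absurd h.2 (by decide)

/-- The map extends over the free letter, the factor `ℤ` and the stable letter in turn. None of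
these layers adds torsion outside conjugates of the preceding one. -/
theorem exists_map (f : A →* A') (hf : KillsTorsion f) (hfu : f u = u') :
    ∃ F : CubeRoot u hu →* CubeRoot u' hu', KillsTorsion F ∧ F (root u hu) = root u' hu' := by
  obtain ⟨S, hS, hSt⟩ := ConjExt.exists_map (α := (1 : Unit →* A)) (β := 1)
    (α' := (1 : Unit →* A')) (β' := 1) (hα := Function.injective_of_subsingleton _)
    (hβ := Function.injective_of_subsingleton _) (hα' := Function.injective_of_subsingleton _)
    (hβ' := Function.injective_of_subsingleton _) f (by simp) (by simp)
  have hSk : KillsTorsion S := killsTorsion_of_comp_of _ fun g hg => by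
    rw [MonoidHom.comp_apply, hS, hf g hg, map_one]
  have hSd : S (doubled u) = doubled u' := by simp [doubled, hS, hSt, hfu]
  obtain ⟨F, hF, hFt⟩ := ConjExt.exists_map (α := cubeHom (FreeStable A)) (β := doubledHom u)
    (α' := cubeHom (FreeStable A')) (β' := doubledHom u') (hα := cubeHom_injective _)
    (hβ := doubledHom_injective hu) (hα' := cubeHom_injective _)
    (hβ' := doubledHom_injective hu') (S.prodMap (MonoidHom.id _))
    (fun c => by simp [cubeHom]) (fun c => by simp [doubledHom, hSd])
  refine ⟨F, killsTorsion_of_comp_of _ (killsTorsion_prod fun s hs => ?_), ?_⟩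
  · have : ((S s, 1) : FreeStable A' × Multiplicative ℤ) = 1 := by rw [hSk s hs]; rfl
    simp [hF, this]
  · simp [root, hF, hFt]

/-- Collapse `A`, the free letter and the stable letter, and reduce the factor `ℤ` modulo 3. Both
sides of the HNN relation become trivial, and torsion of the base has trivial `ℤ`-coordinate. -/
theorem exists_map_multiplicative_zmod : ∃ F : CubeRoot u hu →* Multiplicative (ZMod 3),
    KillsTorsion F ∧ F (root u hu) = Multiplicative.ofAdd 1 := by
  have h3 : ∀ x : Multiplicative (ZMod 3), x ^ 3 = 1 := by decide
  obtain ⟨F, hF, hFt⟩ := ConjExt.exists_lift (α := cubeHom (FreeStable A)) (β := doubledHom u)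
    (hα := cubeHom_injective _) (hβ := doubledHom_injective hu)
    ((zpowersHom _ (Multiplicative.ofAdd (1 : ZMod 3))).comp (MonoidHom.snd _ _)) 1
    (fun c => by
      have : cubeHom (FreeStable A) c = (1, c ^ 3) := rfl
      rw [this, MonoidHom.comp_apply, MonoidHom.coe_snd, map_pow, h3]
      simp [doubledHom])
  refine ⟨F, killsTorsion_of_comp_of _ (killsTorsion_prod fun s hs => ?_), ?_⟩
  · simp [hF]
  · rw [root, map_mul, map_mul, map_inv, hFt, hF]
    simp

end CubeRoot

/-! ### The tower of groups and its torsion-killing maps -/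

/-- A group with a nontrivial element. -/
structure PointedGroup where
  carrier : Type
  [group : Group carrier]
  pt : carrier
  pt_ne_one : pt ≠ 1

attribute [instance] PointedGroup.group

/-- The cyclic group of order three, and the groups obtained from it by adjoining cube roots. -/
noncomputable def tower : ℕ → PointedGroup
  | 0 => ⟨Multiplicative (ZMod 3), Multiplicative.ofAdd 1, by decide⟩
  | n + 1 => ⟨CubeRoot (tower n).pt (tower n).pt_ne_one, CubeRoot.root _ _, CubeRoot.root_ne_one⟩

theorem exists_tower_map (n : ℕ) : ∃ f : (tower (n + 1)).carrier →* (tower n).carrier,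
    KillsTorsion f ∧ f (tower (n + 1)).pt = (tower n).pt := by
  induction n with
  | zero => exact CubeRoot.exists_map_multiplicative_zmod
  | succ n ih =>
    obtain ⟨f, hf, hfu⟩ := ih
    exact CubeRoot.exists_map f hf hfu

theorem exists_tower_family (n : ℕ) : ∃ x : List Bool → (tower n).carrier,
    x [] = (tower n).pt ∧ (∀ η, η.length = n → x η ^ 3 = 1) ∧
    ∀ η, η.length < n → x (η ++ [false]) * x (η ++ [true]) = x η ^ 3 := by
  induction n with
  | zero =>
    refine ⟨fun _ => (tower 0).pt, rfl, fun _ _ => ?_, fun η h => absurd h (by simp)⟩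
    have h3 : ∀ x : Multiplicative (ZMod 3), x ^ 3 = 1 := by decide
    exact h3 _
  | succ n ih =>
    obtain ⟨x, hx, hx3, hxr⟩ := ih
    let ι : (tower n).carrier →* (tower (n + 1)).carrier := CubeRoot.incl _ (tower n).pt_ne_one
    let s : (tower (n + 1)).carrier := CubeRoot.free _ (tower n).pt_ne_one
    -- The first bit selects one of two copies of the family for `n`: the embedded one or its
    -- conjugate by `s`. The relations extend strings at the other end, so they hold inside each
    -- copy; the only new one, at the empty string, is `root_pow`.
    refine ⟨fun η => match η with
      | [] => (tower (n + 1)).pt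
      | false :: η => ι (x η)
      | true :: η => s * ι (x η) * s⁻¹, rfl, ?_, ?_⟩
    · rintro (_ | ⟨_ | _, η⟩) h
      · simp at h
      · have := hx3 η (by simpa using h)
        simp only [← map_pow, this, map_one]
      · have := hx3 η (by simpa using h)
        simp only [conj_pow, ← map_pow, this, map_one, mul_one, mul_inv_cancel]
    · rintro (_ | ⟨_ | _, η⟩) h
      · simp only [List.nil_append, hx]
        exact CubeRoot.root_pow.symm
      · have := hxr η (by simpa using h)
        simp only [List.cons_append, ← map_pow, ← map_mul, this]
      · have := hxr η (by simpa using h)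
        simp only [List.cons_append, conj_mul, conj_pow, ← map_pow, ← map_mul, this]

/-! ### The embedding into a two-generator group -/

/-- The elements `x⁻ⁱ y xⁱ` of the free group on two letters. -/
def conjPowers (x y : Fin 2) : FreeGroup ℕ →* FreeGroup (Fin 2) :=
  FreeGroup.lift fun i => (FreeGroup.of x ^ i)⁻¹ * FreeGroup.of y * FreeGroup.of x ^ i

theorem conjPowers_injective {x y : Fin 2} (h : x ≠ y) :
    Function.Injective (conjPowers x y) := by
  let σ : Multiplicative ℤ →* MulAut (FreeGroup ℤ) :=
    zpowersHom _ (FreeGroup.freeGroupCongr (Equiv.addRight 1))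
  have hσ : ∀ (i : ℕ) (k : ℤ), σ (Multiplicative.ofAdd 1 ^ i) (FreeGroup.of k) =
      FreeGroup.of (k + i) := by
    intro i
    induction i with
    | zero => simp
    | succ i ih =>
      intro k
      rw [pow_succ, map_mul, MulAut.mul_apply]
      have : σ (Multiplicative.ofAdd 1) (FreeGroup.of k) = FreeGroup.of (k + 1) := by simp [σ]
      rw [this, ih]
      push_cast
      ring_nf
  -- With `ℤ` acting by shifts, sending `x` to the inverse of the shift takes `x⁻ⁱ y xⁱ` to the free
  -- generator with index `i`.
  let f : FreeGroup (Fin 2) →* FreeGroup ℤ ⋊[σ] Multiplicative ℤ := FreeGroup.lift fun z =>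
    if z = x then (SemidirectProduct.inr (Multiplicative.ofAdd 1))⁻¹
    else SemidirectProduct.inl (FreeGroup.of 0)
  have hf : f.comp (conjPowers x y) =
      SemidirectProduct.inl.comp (FreeGroup.map (fun i : ℕ => (i : ℤ))) := by
    ext i : 1
    have h1 : f (FreeGroup.of x) = (SemidirectProduct.inr (Multiplicative.ofAdd 1))⁻¹ := by
      simp [f]
    have h2 : f (FreeGroup.of y) = SemidirectProduct.inl (FreeGroup.of 0) := by
      simp [f, h.symm]
    simp only [MonoidHom.comp_apply, conjPowers, FreeGroup.lift_apply_of, map_mul, map_inv,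
      map_pow, h1, h2, FreeGroup.map.of, inv_pow, inv_inv]
    rw [← map_pow, ← map_inv, ← SemidirectProduct.inl_aut, hσ, zero_add]
  have hinj : Function.Injective (f.comp (conjPowers x y)) := by
    rw [hf]
    exact SemidirectProduct.inl_injective.comp (FreeGroup.map_injective Nat.cast_injective)
  exact Function.Injective.of_comp hinj

/-- The group `⟨A × F, t | t⁻¹ yᵢ b⁻ⁱ a bⁱ t = a⁻ⁱ b aⁱ⟩`, for `F` free on `a` and `b`; here the
stable letter of the HNN extension is `t⁻¹`. -/
abbrev TwoGen {A : Type} [Group A] (y : ℕ → A) : Type :=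
  ConjExt ((FreeGroup.lift y).prod (conjPowers 1 0))
    ((MonoidHom.inr A (FreeGroup (Fin 2))).comp (conjPowers 0 1))
    -- Injectivity is read off the free factor, so `y` may be any sequence.
    (fun _ _ h => conjPowers_injective (by decide) (congrArg Prod.snd h))
    (fun _ _ h => conjPowers_injective (by decide) (congrArg Prod.snd h))

namespace TwoGen

variable {A A' : Type} [Group A] [Group A']

/-- The inclusion of `A`. -/
noncomputable def incl (y : ℕ → A) : A →* TwoGen y := HNNExtension.of.comp (MonoidHom.inl _ _)

theorem incl_injective (y : ℕ → A) : Function.Injective (incl y) :=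
  (HNNExtension.of_injective _).comp fun _ _ h => congrArg Prod.fst h

theorem exists_map (y : ℕ → A) (f : A →* A') (hf : KillsTorsion f) :
    ∃ F : TwoGen y →* TwoGen (f ∘ y), KillsTorsion F ∧
      ∀ u, F (incl y u) = incl (f ∘ y) (f u) := by
  obtain ⟨F, hF, -⟩ := ConjExt.exists_map (α := (FreeGroup.lift y).prod (conjPowers 1 0))
    (β := (MonoidHom.inr A (FreeGroup (Fin 2))).comp (conjPowers 0 1))
    (α' := (FreeGroup.lift (f ∘ y)).prod (conjPowers 1 0))
    (β' := (MonoidHom.inr A' (FreeGroup (Fin 2))).comp (conjPowers 0 1))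
    (hα := fun _ _ h => conjPowers_injective (by decide) (congrArg Prod.snd h))
    (hβ := fun _ _ h => conjPowers_injective (by decide) (congrArg Prod.snd h))
    (hα' := fun _ _ h => conjPowers_injective (by decide) (congrArg Prod.snd h))
    (hβ' := fun _ _ h => conjPowers_injective (by decide) (congrArg Prod.snd h))
    (f.prodMap (MonoidHom.id _))
    (fun c => by
      have : FreeGroup.lift (f ∘ y) = f.comp (FreeGroup.lift y) := by ext; simp
      simp [this])
    (fun c => by simp)
  refine ⟨F, killsTorsion_of_comp_of _ (killsTorsion_prod fun s hs => ?_), fun u => ?_⟩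
  · have : ((f s, 1) : A' × FreeGroup (Fin 2)) = 1 := by rw [hf s hs]; rfl
    simp [hF, this]
  · simp [incl, hF]

theorem relation (y : ℕ → A) (i : ℕ) :
    (HNNExtension.t * (incl y (y i) *
      HNNExtension.of (1, (FreeGroup.of 1 ^ i)⁻¹ * FreeGroup.of 0 * FreeGroup.of 1 ^ i)) *
        HNNExtension.t⁻¹ : TwoGen y) =
      HNNExtension.of (1, (FreeGroup.of 0 ^ i)⁻¹ * FreeGroup.of 1 * FreeGroup.of 0 ^ i) := by
  have h := ConjExt.t_conj (α := (FreeGroup.lift y).prod (conjPowers 1 0))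
    (β := (MonoidHom.inr A (FreeGroup (Fin 2))).comp (conjPowers 0 1))
    (hα := fun _ _ h => conjPowers_injective (by decide) (congrArg Prod.snd h))
    (hβ := fun _ _ h => conjPowers_injective (by decide) (congrArg Prod.snd h)) (FreeGroup.of i)
  have h₁ : (FreeGroup.lift y).prod (conjPowers 1 0) (FreeGroup.of i) =
      (y i, (FreeGroup.of 1 ^ i)⁻¹ * FreeGroup.of 0 * FreeGroup.of 1 ^ i) := by
    simp [conjPowers]
  have h₂ : (MonoidHom.inr A (FreeGroup (Fin 2))).comp (conjPowers 0 1) (FreeGroup.of i) =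
      (1, (FreeGroup.of 0 ^ i)⁻¹ * FreeGroup.of 1 * FreeGroup.of 0 ^ i) := by
    simp [conjPowers]
  rw [h₁, h₂] at h
  rw [incl, MonoidHom.comp_apply, ← map_mul, MonoidHom.inl_apply, Prod.mk_mul_mk, mul_one,
    one_mul]
  exact h

end TwoGen

/-- Each map of the tower lowers the torsion level by one. The sequence `y` is arbitrary because it
changes to `f ∘ y` on the way down. -/
theorem incl_pt_notMem_tor (n : ℕ) (y : ℕ → (tower n).carrier) :
    TwoGen.incl y (tower n).pt ∉ tor (TwoGen y) n := by
  induction n with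
  | zero =>
    rw [tor_zero, Subgroup.mem_bot, map_eq_one_iff _ (TwoGen.incl_injective y)]
    exact (tower 0).pt_ne_one
  | succ n ih =>
    obtain ⟨f, hf, hfu⟩ := exists_tower_map n
    obtain ⟨F, hF, hFi⟩ := TwoGen.exists_map y f hf
    intro h
    have := hF.tor_succ_le_comap n h
    rw [Subgroup.mem_comap, hFi, hfu] at this
    exact ih _ this

/-! ### Words as elements of the free group -/

namespace Word

variable {X Y : Type}

theorem mk_letter (x : X) : FreeGroup.mk (letter x) = FreeGroup.of x := rfl

theorem mk_append (u v : Word X) : FreeGroup.mk (u ++ v) = FreeGroup.mk u * FreeGroup.mk v :=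
  FreeGroup.mul_mk.symm

theorem mk_inv (w : Word X) : FreeGroup.mk w.inv = (FreeGroup.mk w)⁻¹ := FreeGroup.inv_mk.symm

theorem mk_pow (w : Word X) (n : ℕ) : FreeGroup.mk (w.pow n) = FreeGroup.mk w ^ n := by
  induction n with
  | zero => rfl
  | succ n ih =>
    have : w.pow (n + 1) = w ++ w.pow n := by simp [pow, List.replicate_succ]
    rw [this, mk_append, ih, pow_succ']

theorem mk_conj (u v : Word X) :
    FreeGroup.mk (u.conj v) = (FreeGroup.mk v)⁻¹ * FreeGroup.mk u * FreeGroup.mk v := by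
  simp only [conj, mk_append, mk_inv]

theorem mk_rel (u v : Word X) :
    FreeGroup.mk (rel u v) = FreeGroup.mk u * (FreeGroup.mk v)⁻¹ := by
  simp only [rel, mk_append, mk_inv]

theorem mk_relabel (f : X → Y) (w : Word X) :
    FreeGroup.mk (w.relabel f) = FreeGroup.map f (FreeGroup.mk w) := rfl

theorem mk_subst (σ : X → Word Y) (w : Word X) :
    FreeGroup.mk (w.subst σ) = FreeGroup.lift (fun x => FreeGroup.mk (σ x)) (FreeGroup.mk w) := by
  induction w with
  | nil => rfl
  | cons p w ih =>
    have h : FreeGroup.mk (p :: w) = FreeGroup.mk [p] * FreeGroup.mk w := by simp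
    have hs : subst σ (p :: w) = (if p.2 then σ p.1 else inv (σ p.1)) ++ subst σ w := by
      simp [subst]
    rw [h, map_mul, ← ih, hs, mk_append]
    congr 1
    obtain ⟨x, _ | _⟩ := p <;> simp [mk_inv]

theorem lift_mk_subst {G : Type*} [Group G] (f : Y → G) (σ : X → Word Y) (w : Word X) :
    FreeGroup.lift f (FreeGroup.mk (w.subst σ)) =
      FreeGroup.lift (fun x => FreeGroup.lift f (FreeGroup.mk (σ x))) (FreeGroup.mk w) := by
  rw [mk_subst, ← MonoidHom.comp_apply]
  congr 1
  ext x
  simp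

theorem lift_mk_relabel {G : Type*} [Group G] (f : Y → G) (g : X → Y) (w : Word X) :
    FreeGroup.lift f (FreeGroup.mk (w.relabel g)) =
      FreeGroup.lift (fun x => f (g x)) (FreeGroup.mk w) := by
  rw [mk_relabel, ← MonoidHom.comp_apply]
  congr 1
  ext x
  simp

end Word

/-- `v` assigns to the generators of `P` elements of a group that satisfy the relations of `P`. -/
def Presentation.Satisfies {X : Type} (P : Presentation X) {G : Type*} [Group G] (v : X → G) :
    Prop :=
  ∀ r ∈ P.rels, FreeGroup.lift v (FreeGroup.mk r) = 1

theorem Presentation.Satisfies.map {X : Type} {P : Presentation X} {G K : Type*} [Group G]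
    [Group K] {v : X → G} (hv : P.Satisfies v) (f : G →* K) : P.Satisfies fun x => f (v x) := by
  intro r hr
  have : FreeGroup.lift (fun x => f (v x)) = f.comp (FreeGroup.lift v) := by ext; simp
  rw [this, MonoidHom.comp_apply, hv r hr, map_one]

theorem satisfies_freeProd_iff {ι : Type} {X : ι → Type} {P : ∀ i, Presentation (X i)}
    {G : Type*} [Group G] {v : (Σ i, X i) → G} :
    (freeProd P).Satisfies v ↔ ∀ i, (P i).Satisfies fun x => v ⟨i, x⟩ := by
  simp only [Presentation.Satisfies, freeProd, Set.mem_iUnion]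
  constructor
  · intro h i r hr
    rw [← Word.lift_mk_relabel]
    exact h _ ⟨i, r, hr, rfl⟩
  · rintro h _ ⟨i, r, hr, rfl⟩
    rw [Word.lift_mk_relabel]
    exact h i r hr

theorem satisfies_finPres_iff {n : ℕ} {G : Type*} [Group G] {v : StringsBelow n → G} :
    (finPres n).Satisfies v ↔
      (∀ (η : List Bool) (h : η.length < n), η.length + 1 = n → v ⟨η, h⟩ ^ 3 = 1) ∧
      ∀ (η : List Bool) (h : η.length < n) (h₀ : (η ++ [false]).length < n)
        (h₁ : (η ++ [true]).length < n),
        v ⟨η ++ [false], h₀⟩ * v ⟨η ++ [true], h₁⟩ = v ⟨η, h⟩ ^ 3 := by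
  constructor
  · intro H
    refine ⟨fun η h hn => ?_, fun η h h₀ h₁ => ?_⟩
    · simpa [strLetter, Word.mk_pow, Word.mk_letter] using H _ (Or.inl ⟨η, h, hn, rfl⟩)
    · simpa [strLetter, Word.mk_pow, Word.mk_letter, Word.mk_rel, Word.mk_append,
        mul_inv_eq_one, -FreeGroup.mul_mk] using H _ (Or.inr ⟨η, h, h₀, h₁, rfl⟩)
  · rintro ⟨H₁, H₂⟩ r (⟨η, h, hn, rfl⟩ | ⟨η, h, h₀, h₁, rfl⟩)
    · simpa [strLetter, Word.mk_pow, Word.mk_letter] using H₁ η h hn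
    · simpa [strLetter, Word.mk_pow, Word.mk_letter, Word.mk_rel, Word.mk_append,
        mul_inv_eq_one, -FreeGroup.mul_mk] using H₂ η h h₀ h₁

/-! ### The group presented by `tgen P x` -/

section Tgen

variable {X : Type} (P : Presentation X) (x : ℕ ≃ X)

/-- The element of the two-generator group that corresponds to a generator of `P`. -/
def tgenLetter (z : X) : (tgen P x).group :=
  PresentedGroup.mk _ (FreeGroup.mk (wordX (x.symm z + 1)))

theorem satisfies_tgenLetter : P.Satisfies (tgenLetter P x) := by
  intro r hr
  have h : (PresentedGroup.mk (FreeGroup.mk '' (tgen P x).rels)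
      (FreeGroup.mk ((r.relabel HNNLetter.base).subst (elimLetter x)))) = 1 :=
    PresentedGroup.one_of_mem ⟨_, ⟨_, Or.inl (Or.inl ⟨r, hr, rfl⟩), rfl⟩, rfl⟩
  rw [Word.mk_subst, Word.lift_mk_relabel, ← MonoidHom.comp_apply] at h
  rw [← h]
  congr 1
  ext z
  simp [tgenLetter, elimLetter]

variable {P}

/-- The sequence `1, v x₁, v x₂, …`. -/
def indexed {A : Type} [Group A] (v : X → A) : ℕ → A
  | 0 => 1
  | i + 1 => v (x i)

theorem exists_hom_tgen {A : Type} [Group A] {v : X → A} (hv : P.Satisfies v) :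
    ∃ F : (tgen P x).group →* TwoGen (indexed x v),
      ∀ z, F (tgenLetter P x z) = TwoGen.incl _ (v z) := by
  let y := indexed x v
  -- The presentation conjugates as `t⁻¹ · t`, the HNN extension as `t · t⁻¹`.
  let T : TwoGen y := HNNExtension.t⁻¹
  let j : FreeGroup (Fin 2) →* TwoGen y := HNNExtension.of.comp (MonoidHom.inr _ _)
  let f : Fin 2 → TwoGen y := ![j (FreeGroup.of 0), T]
  have hrel : ∀ i, T⁻¹ * (TwoGen.incl y (y i) *
      ((j (FreeGroup.of 1) ^ i)⁻¹ * j (FreeGroup.of 0) * j (FreeGroup.of 1) ^ i)) * T =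
      (j (FreeGroup.of 0) ^ i)⁻¹ * j (FreeGroup.of 1) * j (FreeGroup.of 0) ^ i := by
    intro i
    have := TwoGen.relation y i
    simp only [← map_pow, ← map_inv, ← map_mul]
    rw [← inv_inv HNNExtension.t] at this
    exact this
  have hA : FreeGroup.lift f (FreeGroup.mk genA) = j (FreeGroup.of 0) := by
    simp [genA, Word.mk_letter, f]
  have hT : FreeGroup.lift f (FreeGroup.mk genT) = T := by
    simp [genT, Word.mk_letter, f]
  have hB : FreeGroup.lift f (FreeGroup.mk wordB) = j (FreeGroup.of 1) := by
    -- Since `y 0 = 1`, the relation with index 0 reads `t⁻¹ a t = b`.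
    have := hrel 0
    have h0 : y 0 = 1 := rfl
    simp only [h0, map_one, pow_zero, inv_one, one_mul, mul_one] at this
    rw [wordB, Word.mk_conj, map_mul, map_mul, map_inv, hA, hT, this]
  have hX : ∀ i, FreeGroup.lift f (FreeGroup.mk (wordX i)) = TwoGen.incl y (y i) := by
    intro i
    simp only [wordX, Word.mk_append, Word.mk_conj, Word.mk_inv, Word.mk_pow, map_mul, map_inv,
      map_pow, hA, hT, hB, ← hrel]
    group
  have hF : ∀ r ∈ FreeGroup.mk '' (tgen P x).rels, FreeGroup.lift f r = 1 := by
    rintro _ ⟨_, ⟨w, hw, rfl⟩, rfl⟩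
    rw [Word.lift_mk_subst]
    have hb : ∀ z, FreeGroup.lift f (FreeGroup.mk (elimLetter x (.base z))) =
        TwoGen.incl y (v z) := fun z => by
      rw [elimLetter, hX]
      simp [y, indexed]
    rcases hw with (⟨r, hr, rfl⟩ | rfl) | ⟨i, rfl⟩
    · rw [Word.lift_mk_relabel]
      simp only [hb]
      exact hv.map _ r hr
    · simp only [Word.mk_rel, Word.mk_conj, Word.mk_letter, map_mul, map_inv,
        FreeGroup.lift_apply_of, elimLetter, wordB, mul_inv_cancel]
    · simp only [Word.mk_rel, Word.mk_conj, Word.mk_append, Word.mk_pow, Word.mk_letter, map_mul,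
        map_inv, map_pow, FreeGroup.lift_apply_of, hb, mul_inv_eq_one]
      simp only [elimLetter, hA, hB, hT]
      exact hrel (i + 1)
  refine ⟨PresentedGroup.toGroup hF, fun z => ?_⟩
  refine (hX (x.symm z + 1)).trans ?_
  simp [y, indexed]

end Tgen

/-! ### Torsion length -/

/-- Here `j` is the height of the letter above the leaves of the tree. -/
theorem mem_tor_of_satisfies {n : ℕ} {G : Type*} [Group G] {v : StringsBelow n → G}
    (hv : (finPres n).Satisfies v) (j : ℕ) (η : List Bool) (h : η.length + 1 + j = n) :
    v ⟨η, by omega⟩ ∈ tor G (j + 1) := by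
  rw [satisfies_finPres_iff] at hv
  induction j generalizing η with
  | zero =>
    refine mem_tor_succ (n := 3) (by norm_num) ?_
    rw [hv.1 η _ (by omega)]
    exact one_mem _
  | succ j ih =>
    refine mem_tor_succ (n := 3) (by norm_num) ?_
    have h₀ : (η ++ [false]).length + 1 + j = n := by simp; omega
    have h₁ : (η ++ [true]).length + 1 + j = n := by simp; omega
    rw [← hv.2 η _ (by omega) (by omega)]
    exact mul_mem (ih _ h₀) (ih _ h₁)

theorem exists_satisfies_tower (m : ℕ) :
    ∃ v : (Σ n, StringsBelow n) → (tower m).carrier, (freeProd finPres).Satisfies v ∧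
      v ⟨m + 1, [], Nat.succ_pos m⟩ = (tower m).pt := by
  obtain ⟨x, hx, hx3, hxr⟩ := exists_tower_family m
  -- All factors other than `P_{m+1}` are sent to 1.
  refine ⟨fun z => if z.1 = m + 1 then x z.2.1 else 1, ?_, by simp [hx]⟩
  rw [satisfies_freeProd_iff]
  intro n
  rw [satisfies_finPres_iff]
  by_cases hn : n = m + 1
  · subst hn
    simp only [if_true]
    refine ⟨fun η _ hn => hx3 η (by omega), fun η _ h₀ _ => hxr η ?_⟩
    simp at h₀
    omega
  · simp [hn]

theorem torsionLength_tgen (x : ℕ ≃ Σ n, StringsBelow n) :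
    torsionLength (tgen (freeProd finPres) x).group = ⊤ := by
  refine torsionLength_eq_top fun m =>
    ⟨m + 1, tgenLetter _ x ⟨m + 1, [], Nat.succ_pos m⟩, ?_, fun h => ?_⟩
  · exact mem_tor_of_satisfies (satisfies_freeProd_iff.1 (satisfies_tgenLetter _ x) (m + 1)) m []
      (by simp; omega)
  · obtain ⟨v, hv, hv'⟩ := exists_satisfies_tower m
    obtain ⟨F, hF⟩ := exists_hom_tgen x hv
    have := tor_le_comap F m h
    rw [Subgroup.mem_comap, hF, hv'] at this
    exact incl_pt_notMem_tor m _ this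

/-! ### Computably enumerated sets -/

/-- The set is the range of a computable sequence. -/
def IsCompRange {α : Type} [Primcodable α] (s : Set α) : Prop :=
  ∃ f : ℕ → α, Computable f ∧ s = Set.range f

theorem IsCompRange.rePred {α : Type} [Primcodable α] {s : Set α}
    (hs : IsCompRange s) : REPred fun a => a ∈ s := by
  classical
  obtain ⟨f, hf, rfl⟩ := hs
  have hp : Computable₂ fun (a : α) (k : ℕ) => decide (f k = a) :=
    ((Primrec.eq (α := α)).decide.to_comp.comp (hf.comp Computable.snd) Computable.fst).to₂
  refine (Partrec.rfind hp.partrec₂).dom_re.of_eq fun a => ?_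
  simp [Nat.rfind_dom]

theorem IsCompRange.union {α : Type} [Primcodable α] {s s' : Set α} (hs : IsCompRange s)
    (hs' : IsCompRange s') : IsCompRange (s ∪ s') := by
  obtain ⟨f, hf, rfl⟩ := hs
  obtain ⟨g, hg, rfl⟩ := hs'
  -- The two sequences are interleaved by parity.
  refine ⟨fun n => cond n.bodd (f n.div2) (g n.div2),
    Computable.cond Computable.nat_bodd (hf.comp Computable.nat_div2)
      (hg.comp Computable.nat_div2), ?_⟩
  ext a
  constructor
  · rintro (⟨n, rfl⟩ | ⟨n, rfl⟩)
    · exact ⟨Nat.bit true n, by simp only [Nat.bodd_bit, Nat.div2_bit, cond_true]⟩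
    · exact ⟨Nat.bit false n, by simp only [Nat.bodd_bit, Nat.div2_bit, cond_false]⟩
  · rintro ⟨n, rfl⟩
    cases h : n.bodd <;> simp [h]

theorem isCompRange_singleton {α : Type} [Primcodable α] (a : α) : IsCompRange {a} :=
  ⟨fun _ => a, Computable.const a, Set.range_const.symm⟩

/-! ### Operations on words are primitive recursive -/

namespace Word

variable {X Y : Type}

theorem subst_append (σ : X → Word Y) (u v : Word X) :
    subst σ (u ++ v) = subst σ u ++ subst σ v := by
  simp [subst]

theorem subst_letter (σ : X → Word Y) (x : X) : subst σ (letter x) = σ x := by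
  simp [subst, letter]

theorem subst_inv (σ : X → Word Y) (w : Word X) : subst σ w.inv = (subst σ w).inv := by
  induction w with
  | nil => rfl
  | cons p w ih =>
    have h : inv (p :: w) = inv w ++ inv [p] := by simp [inv, FreeGroup.invRev]
    have hs : subst σ (p :: w) = subst σ [p] ++ subst σ w := subst_append σ [p] w
    have ha : ∀ u v : Word Y, inv (u ++ v) = inv v ++ inv u := by
      simp [inv, FreeGroup.invRev]
    rw [h, subst_append, ih, hs, ha]
    congr 1
    obtain ⟨x, _ | _⟩ := p
    · exact (by simp [subst, inv, FreeGroup.invRev] :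
        subst σ (inv [(x, false)]) = σ x).trans (by simp [subst, inv])
    · simp [subst, inv, FreeGroup.invRev]

theorem subst_pow (σ : X → Word Y) (w : Word X) (n : ℕ) :
    subst σ (w.pow n) = (subst σ w).pow n := by
  induction n with
  | zero => rfl
  | succ n ih =>
    have h : ∀ {Z : Type} (w : Word Z), w.pow (n + 1) = w ++ w.pow n := fun w => by
      simp [pow, List.replicate_succ]
    rw [h, h, subst_append, ih]

theorem subst_conj (σ : X → Word Y) (u v : Word X) :
    subst σ (u.conj v) = (subst σ u).conj (subst σ v) := by
  simp only [conj, subst_append, subst_inv]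

theorem subst_rel (σ : X → Word Y) (u v : Word X) :
    subst σ (rel u v) = rel (subst σ u) (subst σ v) := by
  simp only [rel, subst_append, subst_inv]

theorem subst_relabel {Z : Type} (σ : Y → Word Z) (f : X → Y) (w : Word X) :
    subst σ (w.relabel f) = subst (fun x => σ (f x)) w := by
  simp [subst, relabel, List.flatMap_map]

theorem relabel_injective {f : X → Y} (hf : Function.Injective f) :
    Function.Injective (relabel f) :=
  List.map_injective_iff.2 (hf.prodMap Function.injective_id)

variable {α : Type} [Primcodable α] [Primcodable X] [Primcodable Y]

theorem primrec_inv {f : α → Word X} (hf : Primrec f) : Primrec fun a => (f a).inv :=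
  Primrec.list_reverse.comp <| Primrec.list_map hf
    ((Primrec.pair (Primrec.fst.comp Primrec.snd)
      (Primrec.not.comp (Primrec.snd.comp Primrec.snd))).to₂)

theorem primrec_append {f g : α → Word X} (hf : Primrec f) (hg : Primrec g) :
    Primrec fun a => f a ++ g a :=
  Primrec.list_append.comp hf hg

theorem primrec_pow {f : α → Word X} {g : α → ℕ} (hf : Primrec f) (hg : Primrec g) :
    Primrec fun a => (f a).pow (g a) := by
  refine (Primrec.list_flatMap (Primrec.list_range.comp hg)
    ((hf.comp Primrec.fst).to₂ : Primrec₂ fun a (_ : ℕ) => f a)).of_eq fun a => ?_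
  simp [pow, List.flatMap]

theorem primrec_conj {f g : α → Word X} (hf : Primrec f) (hg : Primrec g) :
    Primrec fun a => (f a).conj (g a) :=
  primrec_append (primrec_append (primrec_inv hg) hf) hg

theorem primrec_rel {f g : α → Word X} (hf : Primrec f) (hg : Primrec g) :
    Primrec fun a => rel (f a) (g a) :=
  primrec_append hf (primrec_inv hg)

theorem primrec_letter {f : α → X} (hf : Primrec f) : Primrec fun a => letter (f a) :=
  Primrec.list_cons.comp (Primrec.pair hf (Primrec.const true)) (Primrec.const [])

theorem primrec_subst {σ : X → Word Y} (hσ : Primrec σ) : Primrec (subst σ) := by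
  refine (Primrec.list_flatMap Primrec.id ((Primrec.cond (Primrec.snd.comp Primrec.snd)
    (hσ.comp (Primrec.fst.comp Primrec.snd))
    (primrec_inv (hσ.comp (Primrec.fst.comp Primrec.snd)))).to₂ :
    Primrec₂ fun (_ : Word X) p => cond p.2 (σ p.1) (inv (σ p.1)))).of_eq fun w => ?_
  simp only [subst, id]
  congr 1
  ext p : 1
  cases p.2 <;> rfl

end Word

theorem primrec_wordX : Primrec wordX := by
  have hA : Primrec fun _ : ℕ => genA := Primrec.const _
  have hB : Primrec fun _ : ℕ => wordB := Primrec.const _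
  have hT : Primrec fun _ : ℕ => genT := Primrec.const _
  exact Word.primrec_append (Word.primrec_append (Word.primrec_append hT
    (Word.primrec_conj hB (Word.primrec_pow hA Primrec.id))) (Word.primrec_inv hT))
    (Word.primrec_inv (Word.primrec_conj hA (Word.primrec_pow hB Primrec.id)))

/-- If the relators of `P` are computably enumerated, then so are those of `tgen P x`. -/
theorem isCompRange_tgen {X : Type} {P : Presentation X} {x : ℕ ≃ X}
    (h : IsCompRange {w : Word ℕ | w.relabel x ∈ P.rels}) :
    IsCompRange (tgen P x).rels := by
  obtain ⟨f, hf, hr⟩ := h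
  have hrels : P.rels = Set.range fun k => (f k).relabel x := by
    have hsurj : Function.Surjective (Word.relabel x) :=
      List.map_surjective_iff.2 (x.surjective.prodMap Function.surjective_id)
    ext w
    obtain ⟨w, rfl⟩ := hsurj w
    have : w.relabel x ∈ P.rels ↔ w ∈ Set.range f := by rw [← hr]; rfl
    rw [this]
    exact exists_congr fun k => (Word.relabel_injective x.injective).eq_iff.symm
  have hS : Primrec fun i : ℕ => i + 1 := Primrec.succ
  have hA : Primrec fun _ : ℕ => genA := Primrec.const _
  have hB : Primrec fun _ : ℕ => wordB := Primrec.const _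
  have hT : Primrec fun _ : ℕ => genT := Primrec.const _
  rw [tgen, hnnPres]
  simp only [Set.image_union, Set.image_singleton]
  refine (IsCompRange.union ?_ (isCompRange_singleton _)).union ?_
  -- The enumeration `x` cancels against its inverse in `elimLetter`, so the relators are computed
  -- from indices alone.
  · refine ⟨fun k => Word.subst (fun i => wordX (i + 1)) (f k),
      (Word.primrec_subst (primrec_wordX.comp hS)).to_comp.comp hf, ?_⟩
    rw [hrels, ← Set.range_comp, ← Set.range_comp]
    congr 1
    ext k : 1
    simp only [Function.comp_apply, Word.subst_relabel, elimLetter, Equiv.symm_apply_apply]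
  · refine ⟨fun i => Word.rel ((wordX (i + 1) ++ genA.conj (wordB.pow (i + 1))).conj genT)
      (wordB.conj (genA.pow (i + 1))), Primrec.to_comp <| Word.primrec_rel (Word.primrec_conj
        (Word.primrec_append (primrec_wordX.comp hS) (Word.primrec_conj hA
          (Word.primrec_pow hB hS))) hT) (Word.primrec_conj hB (Word.primrec_pow hA hS)), ?_⟩
    rw [← Set.range_comp]
    congr 1
    ext i : 1
    simp only [Function.comp_apply, Word.subst_rel, Word.subst_conj, Word.subst_append,
      Word.subst_pow, Word.subst_letter, elimLetter, Equiv.symm_apply_apply]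

/-! ### The enumeration of the letters -/

/-- The `n`-th binary string. -/
def binString : ℕ → List Bool
  | 0 => []
  | n + 1 => binString (n / 2) ++ [n.bodd]
decreasing_by omega

/-- The position of a binary string. -/
def binIndex (η : List Bool) : ℕ := η.foldl (fun m b => 2 * m + b.toNat + 1) 0

/-- Heap order: the children of position `i` are at `2i + 1` and `2i + 2`. -/
theorem binIndex_concat (η : List Bool) (b : Bool) :
    binIndex (η ++ [b]) = 2 * binIndex η + b.toNat + 1 := by
  simp [binIndex]

theorem binString_binIndex (η : List Bool) : binString (binIndex η) = η := by
  induction η using List.reverseRecOn with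
  | nil => simp [binIndex, binString]
  | append_singleton η b ih =>
    rw [binIndex_concat, binString]
    have h : (2 * binIndex η + b.toNat) / 2 = binIndex η := by
      cases b
      · simp
      · simp only [Bool.toNat_true]; omega
    rw [h, ih]
    cases b <;> simp

theorem binIndex_binString (n : ℕ) : binIndex (binString n) = n := by
  induction n using Nat.strong_induction_on with
  | _ n ih =>
  cases n with
  | zero => simp [binIndex, binString]
  | succ n =>
    rw [binString, binIndex_concat, ih _ (by omega)]
    have := Nat.bodd_add_div2 n
    rw [Nat.div2_val] at this
    omega

/-- Course-of-values recursion: the parent of position `n + 1` is at `n / 2`, already in the list of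
earlier values. -/
theorem primrec_binString : Primrec binString := by
  have hg : Primrec₂ fun (_ : Unit) (l : List (List Bool)) =>
      Nat.casesOn (motive := fun _ => Option (List Bool)) l.length (some []) fun n =>
        (l[n / 2]?).map fun η => η ++ [n.bodd] := by
    have h₁ : Primrec fun p : (Unit × List (List Bool)) × ℕ => p.1.2[p.2 / 2]? :=
      Primrec.list_getElem?.comp (Primrec.snd.comp Primrec.fst)
        (Primrec.nat_div.comp Primrec.snd (Primrec.const 2))
    have h₂ : Primrec₂ fun (p : (Unit × List (List Bool)) × ℕ) (η : List Bool) =>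
        η ++ [p.2.bodd] :=
      ((Primrec.list_concat (α := Bool)).comp Primrec.snd
        (Primrec.nat_bodd.comp (Primrec.snd.comp Primrec.fst))).to₂
    exact (Primrec.nat_casesOn (Primrec.list_length.comp Primrec.snd) (Primrec.const (some []))
      (Primrec.option_map h₁ h₂).to₂).to₂
  have := Primrec.nat_strong_rec (fun (_ : Unit) n => binString n) hg fun _ n => by
    cases n with
    | zero => simp [binString]
    | succ n =>
      have : n / 2 < n + 1 := by omega
      simp [binString, this]
  exact this.comp (Primrec.const ()) Primrec.id

/-- The enumeration of the letters of all `P_n`. -/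
def letterEquiv : ℕ ≃ Σ n, StringsBelow n where
  -- The index pairs the height `n - 1 - |η|` above the leaves with the position of `η`. Any pair of
  -- naturals is allowed, which gives a bijection.
  toFun k := ⟨(binString k.unpair.2).length + 1 + k.unpair.1, binString k.unpair.2, by omega⟩
  invFun z := Nat.pair (z.1 - 1 - z.2.1.length) (binIndex z.2.1)
  left_inv k := by
    simp only [binIndex_binString]
    have h : ∀ a b, a + 1 + b - 1 - a = b := by omega
    rw [h, Nat.pair_unpair]
  right_inv := by
    have key : ∀ (k n : ℕ) (η : List Bool) (h : η.length < n), binString k.unpair.2 = η →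
        η.length + 1 + k.unpair.1 = n →
        (⟨(binString k.unpair.2).length + 1 + k.unpair.1, binString k.unpair.2, by omega⟩ :
          Σ n, StringsBelow n) = ⟨n, η, h⟩ := by
      rintro k n η h rfl rfl
      rfl
    rintro ⟨n, η, h⟩
    refine key _ n η h ?_ ?_
    · rw [Nat.unpair_pair, binString_binIndex]
    · rw [Nat.unpair_pair]
      simp only
      omega

theorem letterEquiv_pair {n : ℕ} (j : ℕ) (η : List Bool) (h : η.length < n)
    (hn : η.length + 1 + j = n) :
    letterEquiv (Nat.pair j (binIndex η)) = ⟨n, η, h⟩ := by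
  subst hn
  rw [← letterEquiv.apply_symm_apply ⟨_, η, h⟩]
  congr 2
  simp only
  omega

theorem computable_letterEquiv :
    Computable fun k : ℕ => (((letterEquiv k).1, (letterEquiv k).2.1) : ℕ × List Bool) := by
  have h : Primrec fun k : ℕ => binString k.unpair.2 :=
    primrec_binString.comp (Primrec.snd.comp Primrec.unpair)
  exact (Primrec.pair (Primrec.nat_add.comp (Primrec.succ.comp (Primrec.list_length.comp h))
    (Primrec.fst.comp Primrec.unpair)) h).to_comp

/-- The relator that belongs to a letter, as a word in the indices of the letters. -/
def letterRelator (k : ℕ) : Word ℕ :=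
  -- Height 0 marks a leaf. Otherwise the children lie in the same `P_n`, so their height is one
  -- less.
  if k.unpair.1 = 0 then (Word.letter k).pow 3
  else Word.rel
    (Word.letter (Nat.pair (k.unpair.1 - 1) (2 * k.unpair.2 + 1)) ++
      Word.letter (Nat.pair (k.unpair.1 - 1) (2 * k.unpair.2 + 2)))
    ((Word.letter k).pow 3)

theorem primrec_letterRelator : Primrec letterRelator := by
  have h₁ : Primrec fun k : ℕ => k.unpair.1 := Primrec.fst.comp Primrec.unpair
  have h₂ : Primrec fun k : ℕ => k.unpair.2 := Primrec.snd.comp Primrec.unpair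
  have h₃ : Primrec fun k : ℕ => (Word.letter k).pow 3 :=
    Word.primrec_pow (Word.primrec_letter Primrec.id) (Primrec.const 3)
  have h₄ : ∀ c, Primrec fun k : ℕ =>
      Word.letter (Nat.pair (k.unpair.1 - 1) (2 * k.unpair.2 + c)) := fun c =>
    Word.primrec_letter (Primrec₂.natPair.comp (Primrec.nat_sub.comp h₁ (Primrec.const 1))
      (Primrec.nat_add.comp (Primrec.nat_mul.comp (Primrec.const 2) h₂) (Primrec.const c)))
  exact Primrec.ite (Primrec.eq.comp h₁ (Primrec.const 0)) h₃
    (Word.primrec_rel (Word.primrec_append (h₄ 1) (h₄ 2)) h₃)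

theorem relabel_letterRelator_zero (η : List Bool) :
    (letterRelator (Nat.pair 0 (binIndex η))).relabel letterEquiv =
      Word.relabel (Sigma.mk (η.length + 1)) ((strLetter η (Nat.lt_succ_self _)).pow 3) := by
  simp [letterRelator, Word.relabel, Word.pow, Word.letter, strLetter,
    letterEquiv_pair 0 η (Nat.lt_succ_self _) rfl]

theorem relabel_letterRelator_succ {n : ℕ} (j : ℕ) (η : List Bool)
    (hn : η.length + 1 + (j + 1) = n) (h : η.length < n) (h₀ : (η ++ [false]).length < n)
    (h₁ : (η ++ [true]).length < n) :
    (letterRelator (Nat.pair (j + 1) (binIndex η))).relabel letterEquiv =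
      Word.relabel (Sigma.mk n) (Word.rel (strLetter (η ++ [false]) h₀ ++
        strLetter (η ++ [true]) h₁) ((strLetter η h).pow 3)) := by
  have e := letterEquiv_pair (j + 1) η h hn
  have e₀ := letterEquiv_pair j _ h₀ (by simp; omega)
  have e₁ := letterEquiv_pair j _ h₁ (by simp; omega)
  rw [binIndex_concat] at e₀ e₁
  simp only [Bool.toNat_false, Bool.toNat_true, add_zero] at e₀ e₁
  simp [letterRelator, Word.relabel, Word.pow, Word.letter, strLetter, Word.rel, Word.inv,
    FreeGroup.invRev, e, e₀, e₁]

/-- Every letter owns exactly one relator, so enumerating letters enumerates relators. -/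
theorem rels_freeProd_finPres : (freeProd finPres).rels =
    Set.range fun k => (letterRelator k).relabel letterEquiv := by
  ext w
  simp only [freeProd, Set.mem_iUnion]
  constructor
  · rintro ⟨n, r, ⟨η, h, rfl, rfl⟩ | ⟨η, h, h₀, h₁, rfl⟩, rfl⟩
    · exact ⟨_, relabel_letterRelator_zero η⟩
    · have h₀' : η.length + 1 < n := by simpa using h₀
      obtain ⟨j, hj⟩ : ∃ j, η.length + 1 + (j + 1) = n := ⟨n - η.length - 2, by omega⟩
      exact ⟨_, relabel_letterRelator_succ j η hj h h₀ h₁⟩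
  · rintro ⟨k, rfl⟩
    obtain ⟨j, η, rfl⟩ : ∃ j η, Nat.pair j (binIndex η) = k :=
      ⟨k.unpair.1, binString k.unpair.2, by rw [binIndex_binString, Nat.pair_unpair]⟩
    cases j with
    | zero => exact ⟨_, _, Or.inl ⟨η, _, rfl, rfl⟩, (relabel_letterRelator_zero η).symm⟩
    | succ j =>
      exact ⟨_, _, Or.inr ⟨η, by omega, by simp, by simp, rfl⟩,
        (relabel_letterRelator_succ j η rfl _ _ _).symm⟩

theorem isCompRange_freeProd_finPres :
    IsCompRange {w : Word ℕ | w.relabel letterEquiv ∈ (freeProd finPres).rels} := by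
  refine ⟨letterRelator, primrec_letterRelator.to_comp, ?_⟩
  rw [rels_freeProd_finPres]
  ext w
  exact exists_congr fun k => (Word.relabel_injective letterEquiv.injective).eq_iff

end TorLen

/-- Some recursive enumeration `x` of the letters makes `P_0 * P_1 * ⋯` a countably generated
recursive presentation, and the two-generator presentation `Q` built from it is recursive and
presents a group of infinite torsion length. -/
theorem theorem6 :
    ∃ x : ℕ ≃ (Σ n : ℕ, TorLen.StringsBelow n),
      Computable (fun k : ℕ => (((x k).1, (x k).2.1) : ℕ × List Bool)) ∧
      (TorLen.freeProd TorLen.finPres).IsRecursiveVia x ∧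
      ∃ Q : TorLen.Presentation (Fin 2),
        Q = TorLen.tgen (TorLen.freeProd TorLen.finPres) x ∧
        Q.IsRecursive ∧
        TorLen.torsionLength Q.group = ⊤ :=
  ⟨TorLen.letterEquiv, TorLen.computable_letterEquiv, TorLen.isCompRange_freeProd_finPres.rePred,
    _, rfl, (TorLen.isCompRange_tgen TorLen.isCompRange_freeProd_finPres).rePred,
    TorLen.torsionLength_tgen _⟩
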